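/- Let $G$ be a finite group and let $\omega\colon G^3\to\mathbb C^\times$ be a normalized $3$-cocycle. Let $\mathrm{Vect}_G^\omega$ be the category of finite-dimensional $G$-graded complex vector spaces with associativity constraint $(u\otimes v)\otimes w\mapsto\omega(|u|,|v|,|w|)\,u\otimes(v\otimes w)$ for homogeneous $u,v,w$. Let $\mathcal Z(\mathrm{Vect}_G^\omega)$ be its (right) Drinfeld center, whose objects $W$ carry half-braidings $\sigma\colon V\otimes W\to W\otimes V$, $v\otimes w\mapsto(|v|\triangleright w)\otimes v$. A simple object corresponds to a pair $(g,\chi)$ if the degrees of its nonzero homogeneous components form the conjugacy class $\overline g$ and $\chi$ is the projective character of $C_G(g)$ acting by $\triangleright$ on the component of degree $g$. For simple objects $U,V,W$ corresponding to $(g,\chi_1),(h,\chi_2),(k,\chi_3)$, let $$B_{(g,\chi_1),(h,\chi_2),(k,\chi_3)}$$ be the pivotal trace (for the canonical pivotal structure, that is, the trace of the underlying linear map) of the automorphism of $(U\otimes V)\otimes W$ given by the braid $(\sigma_2^{-1}\sigma_1)^3$, whose closure is the Borromean link. Write $x\triangleright y=xyx^{-1}$, $[x,y]=xyx^{-1}y^{-1}$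 and $g^Q=\{q\triangleright g: q\in Q\}$. Let $A$ be an abelian normal subgroup of $G$ such that $\omega$ is inflated from $G/A$, that is, $\omega(x,y,z)=\omega'(xA,yA,zA)$ for a normalized $3$-cocycle $\omega'$ of $G/A$. Let $g,h\in A$ and $k\in G$. 1. If $Q\subset C_G(k)$ is a subgroup with $g^Q=\overline g$ and $h^Q=\overline h$, then $$B_{(g,\chi_1),(h,\chi_2),(k,\chi_3)}=\frac{|\overline k|\,|Q|\,\chi_3(1)}{|C_Q(g)|\,|C_Q(h)|}\sum_{q\in Q}\chi_1\bigl(q\triangleright[h,k]\bigr)\,\chi_2\bigl(q^{-1}\triangleright[k^{-1},g^{-1}]\bigr).$$ 2. The conditions on $Q$ in 1. hold for example when $G=A\rtimes Q$ is a semidirect product with $Q$ abelian and $k\in Q$. -/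

import Mathlib

open CategoryTheory MonoidalCategory TensorProduct
open scoped commutatorElement

universe u

noncomputable section

/-- A normalized 3-cocycle on the group `G` with values in `ℂˣ` (trivial action). -/
structure NormalizedThreeCocycle (G : Type u) [Group G] where
  toFun : G → G → G → ℂˣ
  cocycle : ∀ x y z w : G,
    toFun y z w * toFun x (y * z) w * toFun x y z = toFun (x * y) z w * toFun x y (z * w)
  one_left : ∀ y z : G, toFun 1 y z = 1
  one_middle : ∀ x z : G, toFun x 1 z = 1
  one_right : ∀ x y : G, toFun x y 1 = 1

/-- Inflation of a 3-cocycle along the quotient map `G → G ⧸ A`. -/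
def NormalizedThreeCocycle.inflate {G : Type u} [Group G] {A : Subgroup G} [A.Normal]
    (ω : NormalizedThreeCocycle (G ⧸ A)) : NormalizedThreeCocycle G where
  toFun x y z := ω.toFun (x : G ⧸ A) (y : G ⧸ A) (z : G ⧸ A)
  cocycle x y z w := ω.cocycle x y z w
  one_left y z := ω.one_left y z
  one_middle x z := ω.one_middle x z
  one_right x y := ω.one_right x y

/-- The objects of `Vect_G^ω`: finite-dimensional complex vector spaces `V` with a grading
`V = ⨁ x : G, V_x`. The grading is recorded by its projections `proj x : V → V` onto the
homogeneous components, so that `V_x` is the range of `proj x`. The cocycle `ω` only enters in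
the associativity constraint. -/
structure VectG {G : Type u} [Group G] [Fintype G] (ω : NormalizedThreeCocycle G) where
  carrier : Type
  [addCommGroup : AddCommGroup carrier]
  [module : Module ℂ carrier]
  [finiteDimensional : FiniteDimensional ℂ carrier]
  proj : G → carrier →ₗ[ℂ] carrier
  proj_self : ∀ (x : G) (v : carrier), proj x (proj x v) = proj x v
  proj_of_ne : ∀ (x y : G) (v : carrier), x ≠ y → proj x (proj y v) = 0
  sum_proj : ∀ v : carrier, ∑ x, proj x v = v

namespace VectG

variable {G : Type u} [Group G] [Fintype G] {ω : NormalizedThreeCocycle G}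

instance : CoeSort (VectG ω) Type := ⟨carrier⟩

attribute [instance] addCommGroup module finiteDimensional

/-- `v` lies in the homogeneous component `V_x`. -/
def IsHomog (V : VectG ω) (x : G) (v : V) : Prop := V.proj x v = v

theorem isHomog_proj (V : VectG ω) (x : G) (v : V) : V.IsHomog x (V.proj x v) :=
  V.proj_self x v

theorem IsHomog.proj_of_ne {V : VectG ω} {x : G} {v : V} (hv : V.IsHomog x v) {y : G}
    (h : y ≠ x) : V.proj y v = 0 := by
  rw [← hv]
  exact V.proj_of_ne y x v h

theorem IsHomog.smul {V : VectG ω} {x : G} {v : V} (hv : V.IsHomog x v) (c : ℂ) :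
    V.IsHomog x (c • v) := by
  unfold IsHomog at *
  rw [map_smul, hv]

theorem homog_induction (V : VectG ω) {p : V → Prop} (hadd : ∀ v w, p v → p w → p (v + w))
    (hz : p 0) (hh : ∀ x v, V.IsHomog x v → p v) (v : V) : p v := by
  rw [← V.sum_proj v]
  exact Finset.sum_induction _ p hadd hz fun x _ => hh x _ (V.isHomog_proj x v)

theorem lin_ext (V : VectG ω) {M : Type*} [AddCommGroup M] [Module ℂ M] {f f' : V →ₗ[ℂ] M}
    (h : ∀ x v, V.IsHomog x v → f v = f' v) : f = f' := by
  ext v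
  refine V.homog_induction (p := fun v => f v = f' v) ?_ ?_ h v
  · intro v w hv hw
    simp only [map_add, hv, hw]
  · simp

theorem lin_ext₂ (V W : VectG ω) {M : Type*} [AddCommGroup M] [Module ℂ M]
    {f f' : (V : Type) ⊗[ℂ] (W : Type) →ₗ[ℂ] M}
    (h : ∀ x v y w, V.IsHomog x v → W.IsHomog y w → f (v ⊗ₜ w) = f' (v ⊗ₜ w)) : f = f' := by
  apply TensorProduct.ext
  apply V.lin_ext
  intro x v hv
  apply W.lin_ext
  intro y w hw
  exact h x v y w hv hw

/-- Morphisms of `Vect_G^ω`: linear maps that preserve the grading. -/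
@[ext]
structure Hom (V W : VectG ω) where
  lin : (V : Type) →ₗ[ℂ] (W : Type)
  comm : ∀ (x : G) (v : V), W.proj x (lin v) = lin (V.proj x v)

instance : Category (VectG ω) where
  Hom := Hom
  id V := ⟨LinearMap.id, fun _ _ => rfl⟩
  comp f g := ⟨g.lin ∘ₗ f.lin, fun x v => by
    simp only [LinearMap.comp_apply, g.comm, f.comm]⟩

@[ext]
theorem hom_ext {V W : VectG ω} {f g : V ⟶ W} (h : f.lin = g.lin) : f = g := Hom.ext h

@[simp] theorem id_lin (V : VectG ω) : (𝟙 V : V ⟶ V).lin = LinearMap.id := rfl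

@[simp] theorem comp_lin {U V W : VectG ω} (f : U ⟶ V) (g : V ⟶ W) :
    (f ≫ g).lin = g.lin ∘ₗ f.lin := rfl

theorem IsHomog.map {V W : VectG ω} {x : G} {v : V} (hv : V.IsHomog x v) (f : V ⟶ W) :
    W.IsHomog x (f.lin v) := by
  unfold IsHomog at *
  rw [f.comm, hv]

/-- The tensor product, with `(V ⊗ W)_x = ⨁_{a b = x} V_a ⊗ W_b`. -/
def tensorProj (V W : VectG ω) (x : G) :
    (V : Type) ⊗[ℂ] (W : Type) →ₗ[ℂ] (V : Type) ⊗[ℂ] (W : Type) :=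
  ∑ a : G, TensorProduct.map (V.proj a) (W.proj (a⁻¹ * x))

theorem tensorProj_self {V W : VectG ω} {x y : G} {v : V} {w : W} (hv : V.IsHomog x v)
    (hw : W.IsHomog y w) : tensorProj V W (x * y) (v ⊗ₜ w) = v ⊗ₜ w := by
  unfold tensorProj
  rw [LinearMap.sum_apply, Finset.sum_eq_single x]
  · rw [TensorProduct.map_tmul, inv_mul_cancel_left, hv, hw]
  · intro a _ ha
    rw [TensorProduct.map_tmul, hv.proj_of_ne ha, TensorProduct.zero_tmul]
  · intro h
    exact absurd (Finset.mem_univ x) h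

theorem tensorProj_of_ne {V W : VectG ω} {x y z : G} {v : V} {w : W} (hv : V.IsHomog x v)
    (hw : W.IsHomog y w) (h : z ≠ x * y) : tensorProj V W z (v ⊗ₜ w) = 0 := by
  unfold tensorProj
  rw [LinearMap.sum_apply]
  refine Finset.sum_eq_zero fun a _ => ?_
  rw [TensorProduct.map_tmul]
  by_cases ha : a = x
  · subst ha
    rw [hw.proj_of_ne, TensorProduct.tmul_zero]
    intro h'
    exact h (by rw [← h', mul_inv_cancel_left])
  · rw [hv.proj_of_ne ha, TensorProduct.zero_tmul]

/-- The tensor product of graded vector spaces. -/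
@[reducible] def tensor (V W : VectG ω) : VectG ω where
  carrier := (V : Type) ⊗[ℂ] (W : Type)
  proj := tensorProj V W
  proj_self z t := by
    change (tensorProj V W z ∘ₗ tensorProj V W z) t = tensorProj V W z t
    congr 1
    refine lin_ext₂ V W fun x v y w hv hw => ?_
    rw [LinearMap.comp_apply]
    by_cases h : z = x * y
    · subst h
      rw [tensorProj_self hv hw, tensorProj_self hv hw]
    · rw [tensorProj_of_ne hv hw h, map_zero]
  proj_of_ne z z' t hz := by
    change (tensorProj V W z ∘ₗ tensorProj V W z') t =
      (0 : (V : Type) ⊗[ℂ] (W : Type) →ₗ[ℂ] (V : Type) ⊗[ℂ] (W : Type)) t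
    congr 1
    refine lin_ext₂ V W fun x v y w hv hw => ?_
    rw [LinearMap.comp_apply, LinearMap.zero_apply]
    by_cases h : z' = x * y
    · subst h
      rw [tensorProj_self hv hw, tensorProj_of_ne hv hw hz]
    · rw [tensorProj_of_ne hv hw h, map_zero]
  sum_proj t := by
    rw [← LinearMap.sum_apply]
    change (∑ z, tensorProj V W z) t =
      (LinearMap.id : (V : Type) ⊗[ℂ] (W : Type) →ₗ[ℂ] (V : Type) ⊗[ℂ] (W : Type)) t
    congr 1
    refine lin_ext₂ V W fun x v y w hv hw => ?_
    rw [LinearMap.sum_apply, Finset.sum_eq_single (x * y), tensorProj_self hv hw]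
    · rfl
    · intro z _ hz
      exact tensorProj_of_ne hv hw hz
    · intro h
      exact absurd (Finset.mem_univ _) h

theorem IsHomog.tmul {V W : VectG ω} {x y : G} {v : V} {w : W} (hv : V.IsHomog x v)
    (hw : W.IsHomog y w) : (tensor V W).IsHomog (x * y) (v ⊗ₜ[ℂ] w) :=
  tensorProj_self hv hw

theorem lin_ext₃ (U V W : VectG ω) {M : Type*} [AddCommGroup M] [Module ℂ M]
    {f f' : ((U : Type) ⊗[ℂ] (V : Type)) ⊗[ℂ] (W : Type) →ₗ[ℂ] M}
    (h : ∀ x u y v z w, U.IsHomog x u → V.IsHomog y v → W.IsHomog z w →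
      f ((u ⊗ₜ v) ⊗ₜ w) = f' ((u ⊗ₜ v) ⊗ₜ w)) : f = f' := by
  apply TensorProduct.ext
  apply lin_ext₂
  intro x u y v hu hv
  apply W.lin_ext
  intro z w hw
  exact h x u y v z w hu hv hw

theorem lin_ext₃' (U V W : VectG ω) {M : Type*} [AddCommGroup M] [Module ℂ M]
    {f f' : (U : Type) ⊗[ℂ] ((V : Type) ⊗[ℂ] (W : Type)) →ₗ[ℂ] M}
    (h : ∀ x u y v z w, U.IsHomog x u → V.IsHomog y v → W.IsHomog z w →
      f (u ⊗ₜ (v ⊗ₜ w)) = f' (u ⊗ₜ (v ⊗ₜ w))) : f = f' := by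
  apply TensorProduct.ext
  apply U.lin_ext
  intro x u hu
  apply lin_ext₂
  intro y v z w hv hw
  exact h x u y v z w hu hv hw

theorem lin_ext₄ (T U V W : VectG ω) {M : Type*} [AddCommGroup M] [Module ℂ M]
    {f f' : (((T : Type) ⊗[ℂ] (U : Type)) ⊗[ℂ] (V : Type)) ⊗[ℂ] (W : Type) →ₗ[ℂ] M}
    (h : ∀ s t x u y v z w, T.IsHomog s t → U.IsHomog x u → V.IsHomog y v → W.IsHomog z w →
      f (((t ⊗ₜ u) ⊗ₜ v) ⊗ₜ w) = f' (((t ⊗ₜ u) ⊗ₜ v) ⊗ₜ w)) : f = f' := by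
  apply TensorProduct.ext
  apply lin_ext₃
  intro s t x u y v ht hu hv
  apply W.lin_ext
  intro z w hw
  exact h s t x u y v z w ht hu hv hw

/-- A linear map which is compatible with the degrees of homogeneous tensors is a morphism. -/
theorem comm_of_homog {V W X : VectG ω} {f : (V : Type) ⊗[ℂ] (W : Type) →ₗ[ℂ] (X : Type)}
    (h : ∀ x v y w, V.IsHomog x v → W.IsHomog y w → X.IsHomog (x * y) (f (v ⊗ₜ w))) (z : G)
    (t : (V : Type) ⊗[ℂ] (W : Type)) : X.proj z (f t) = f (tensorProj V W z t) := by
  change (X.proj z ∘ₗ f) t = (f ∘ₗ tensorProj V W z) t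
  congr 1
  refine lin_ext₂ V W fun x v y w hv hw => ?_
  rw [LinearMap.comp_apply, LinearMap.comp_apply]
  by_cases hz : z = x * y
  · subst hz
    rw [tensorProj_self hv hw]
    exact h x v y w hv hw
  · rw [tensorProj_of_ne hv hw hz, map_zero]
    exact (h x v y w hv hw).proj_of_ne hz

/-- The tensor product of morphisms. -/
def tensorMap {V V' W W' : VectG ω} (f : V ⟶ V') (g : W ⟶ W') : tensor V W ⟶ tensor V' W' where
  lin := TensorProduct.map f.lin g.lin
  comm := comm_of_homog fun _ _ _ _ hv hw => (hv.map f).tmul (hw.map g)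

/-- The linear map `(u ⊗ v) ⊗ w ↦ ω(|u|, |v|, |w|) • u ⊗ (v ⊗ w)` (`u, v, w` homogeneous). -/
def assocLin (U V W : VectG ω) : ((U : Type) ⊗[ℂ] (V : Type)) ⊗[ℂ] (W : Type) →ₗ[ℂ]
    (U : Type) ⊗[ℂ] ((V : Type) ⊗[ℂ] (W : Type)) :=
  ∑ x : G, ∑ y : G, ∑ z : G, ((ω.toFun x y z : ℂˣ) : ℂ) •
    (TensorProduct.map (U.proj x) (TensorProduct.map (V.proj y) (W.proj z)) ∘ₗ
      (TensorProduct.assoc ℂ U V W).toLinearMap)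

/-- The linear map `u ⊗ (v ⊗ w) ↦ ω(|u|, |v|, |w|)⁻¹ • (u ⊗ v) ⊗ w` (`u, v, w` homogeneous). -/
def assocInvLin (U V W : VectG ω) : (U : Type) ⊗[ℂ] ((V : Type) ⊗[ℂ] (W : Type)) →ₗ[ℂ]
    ((U : Type) ⊗[ℂ] (V : Type)) ⊗[ℂ] (W : Type) :=
  ∑ x : G, ∑ y : G, ∑ z : G, (((ω.toFun x y z)⁻¹ : ℂˣ) : ℂ) •
    (TensorProduct.map (TensorProduct.map (U.proj x) (V.proj y)) (W.proj z) ∘ₗ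
      (TensorProduct.assoc ℂ U V W).symm.toLinearMap)

theorem assocLin_tmul {U V W : VectG ω} {x y z : G} {u : U} {v : V} {w : W}
    (hu : U.IsHomog x u) (hv : V.IsHomog y v) (hw : W.IsHomog z w) :
    assocLin U V W ((u ⊗ₜ v) ⊗ₜ w) = ((ω.toFun x y z : ℂˣ) : ℂ) • (u ⊗ₜ (v ⊗ₜ w)) := by
  unfold assocLin
  simp only [LinearMap.sum_apply, LinearMap.smul_apply, LinearMap.comp_apply,
    LinearEquiv.coe_coe, TensorProduct.assoc_tmul, TensorProduct.map_tmul]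
  rw [Finset.sum_eq_single x, Finset.sum_eq_single y, Finset.sum_eq_single z, hu, hv, hw]
  · intro c _ hc
    simp [hw.proj_of_ne hc]
  · simp
  · intro c _ hc
    simp [hv.proj_of_ne hc]
  · simp
  · intro c _ hc
    simp [hu.proj_of_ne hc]
  · simp

theorem assocInvLin_tmul {U V W : VectG ω} {x y z : G} {u : U} {v : V} {w : W}
    (hu : U.IsHomog x u) (hv : V.IsHomog y v) (hw : W.IsHomog z w) :
    assocInvLin U V W (u ⊗ₜ (v ⊗ₜ w)) = (((ω.toFun x y z)⁻¹ : ℂˣ) : ℂ) • ((u ⊗ₜ v) ⊗ₜ w) := by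
  unfold assocInvLin
  simp only [LinearMap.sum_apply, LinearMap.smul_apply, LinearMap.comp_apply,
    LinearEquiv.coe_coe, TensorProduct.assoc_symm_tmul, TensorProduct.map_tmul]
  rw [Finset.sum_eq_single x, Finset.sum_eq_single y, Finset.sum_eq_single z, hu, hv, hw]
  · intro c _ hc
    simp [hw.proj_of_ne hc]
  · simp
  · intro c _ hc
    simp [hv.proj_of_ne hc]
  · simp
  · intro c _ hc
    simp [hu.proj_of_ne hc]
  · simp

/-- The associativity constraint `Φ` of `Vect_G^ω`. -/
def assoc (U V W : VectG ω) : tensor (tensor U V) W ≅ tensor U (tensor V W) where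
  hom :=
    { lin := assocLin U V W
      comm := fun a t => by
        change (tensorProj U (tensor V W) a ∘ₗ assocLin U V W) t =
          (assocLin U V W ∘ₗ tensorProj (tensor U V) W a) t
        congr 1
        refine lin_ext₃ U V W fun x u y v z w hu hv hw => ?_
        rw [LinearMap.comp_apply, LinearMap.comp_apply, assocLin_tmul hu hv hw, map_smul]
        by_cases ha : a = x * y * z
        · subst ha
          rw [tensorProj_self (hu.tmul hv) hw, assocLin_tmul hu hv hw, mul_assoc,
            tensorProj_self hu (hv.tmul hw)]
        · rw [tensorProj_of_ne (hu.tmul hv) hw ha, map_zero,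
            tensorProj_of_ne hu (hv.tmul hw) (by rwa [← mul_assoc]), smul_zero] }
  inv :=
    { lin := assocInvLin U V W
      comm := fun a t => by
        change (tensorProj (tensor U V) W a ∘ₗ assocInvLin U V W) t =
          (assocInvLin U V W ∘ₗ tensorProj U (tensor V W) a) t
        congr 1
        refine lin_ext₃' U V W fun x u y v z w hu hv hw => ?_
        rw [LinearMap.comp_apply, LinearMap.comp_apply, assocInvLin_tmul hu hv hw, map_smul]
        by_cases ha : a = x * y * z
        · subst ha
          rw [tensorProj_self (hu.tmul hv) hw, mul_assoc,
            tensorProj_self hu (hv.tmul hw), assocInvLin_tmul hu hv hw]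
        · rw [tensorProj_of_ne (hu.tmul hv) hw ha,
            tensorProj_of_ne hu (hv.tmul hw) (by rwa [← mul_assoc]), smul_zero, map_zero] }
  hom_inv_id := by
    apply hom_ext
    refine lin_ext₃ U V W fun x u y v z w hu hv hw => ?_
    change assocInvLin U V W (assocLin U V W ((u ⊗ₜ v) ⊗ₜ w)) = (u ⊗ₜ v) ⊗ₜ w
    rw [assocLin_tmul hu hv hw, map_smul, assocInvLin_tmul hu hv hw, smul_smul,
      ← Units.val_mul, mul_inv_cancel, Units.val_one, one_smul]
  inv_hom_id := by
    apply hom_ext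
    refine lin_ext₃' U V W fun x u y v z w hu hv hw => ?_
    change assocLin U V W (assocInvLin U V W (u ⊗ₜ (v ⊗ₜ w))) = u ⊗ₜ (v ⊗ₜ w)
    rw [assocInvLin_tmul hu hv hw, map_smul, assocLin_tmul hu hv hw, smul_smul,
      ← Units.val_mul, inv_mul_cancel, Units.val_one, one_smul]

open Classical in
/-- The one-dimensional graded space `ℂ` concentrated in degree `x`. -/
@[reducible] def line (ω : NormalizedThreeCocycle G) (x : G) : VectG ω where
  carrier := ℂ
  proj y := if y = x then LinearMap.id else 0
  proj_self y v := by
    by_cases h : y = x <;> simp [h]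
  proj_of_ne y z v h := by
    by_cases hy : y = x
    · have hz : ¬ z = x := fun hz => h (hy.trans hz.symm)
      simp [hz]
    · simp [hy]
  sum_proj v := by
    rw [Finset.sum_eq_single x]
    · simp
    · intro b _ hb
      simp [hb]
    · simp

theorem line_isHomog (x : G) (c : ℂ) : (line ω x).IsHomog x c := by
  unfold IsHomog line
  simp only [if_true]
  rfl

/-- The left unit constraint `1 ⊗ v ↦ v`. -/
def leftUnit (V : VectG ω) : tensor (line ω 1) V ≅ V where
  hom :=
    { lin := (TensorProduct.lid ℂ V).toLinearMap
      comm := fun z t => by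
        have key : V.proj z ∘ₗ (TensorProduct.lid ℂ V).toLinearMap =
            (TensorProduct.lid ℂ V).toLinearMap ∘ₗ tensorProj (line ω 1) V z := by
          apply TensorProduct.ext
          apply LinearMap.ext
          intro c
          apply V.lin_ext
          intro y v hv
          have hc := line_isHomog (ω := ω) 1 c
          change V.proj z (c • v) =
            TensorProduct.lid ℂ V (tensorProj (line ω 1) V z (c ⊗ₜ v))
          by_cases hz : z = 1 * y
          · subst hz
            rw [tensorProj_self hc hv]
            change V.proj (1 * y) (c • v) = c • v
            rw [one_mul]
            exact hv.smul c
          · rw [tensorProj_of_ne hc hv hz, map_zero]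
            rw [one_mul] at hz
            exact (hv.smul c).proj_of_ne hz
        exact LinearMap.congr_fun key t }
  inv :=
    { lin := (TensorProduct.lid ℂ V).symm.toLinearMap
      comm := fun z t => by
        have key : tensorProj (line ω 1) V z ∘ₗ (TensorProduct.lid ℂ V).symm.toLinearMap =
            (TensorProduct.lid ℂ V).symm.toLinearMap ∘ₗ V.proj z := by
          apply V.lin_ext
          intro y v hv
          have hc := line_isHomog (ω := ω) 1 1
          change tensorProj (line ω 1) V z ((1 : ℂ) ⊗ₜ v) = (1 : ℂ) ⊗ₜ (V.proj z v)
          by_cases hz : z = 1 * y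
          · subst hz
            rw [tensorProj_self hc hv, one_mul, hv]
          · rw [tensorProj_of_ne hc hv hz]
            rw [one_mul] at hz
            rw [hv.proj_of_ne hz, TensorProduct.tmul_zero]
        exact LinearMap.congr_fun key t }
  hom_inv_id := by
    apply hom_ext
    apply LinearMap.ext
    intro t
    exact (TensorProduct.lid ℂ V).symm_apply_apply t
  inv_hom_id := by
    apply hom_ext
    apply LinearMap.ext
    intro t
    exact (TensorProduct.lid ℂ V).apply_symm_apply t

/-- The right unit constraint `v ⊗ 1 ↦ v`. -/
def rightUnit (V : VectG ω) : tensor V (line ω 1) ≅ V where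
  hom :=
    { lin := (TensorProduct.rid ℂ V).toLinearMap
      comm := fun z t => by
        have key : V.proj z ∘ₗ (TensorProduct.rid ℂ V).toLinearMap =
            (TensorProduct.rid ℂ V).toLinearMap ∘ₗ tensorProj V (line ω 1) z := by
          apply TensorProduct.ext
          apply V.lin_ext
          intro y v hv
          apply LinearMap.ext
          intro c
          have hc := line_isHomog (ω := ω) 1 c
          change V.proj z (c • v) =
            TensorProduct.rid ℂ V (tensorProj V (line ω 1) z (v ⊗ₜ c))
          by_cases hz : z = y * 1
          · subst hz
            rw [tensorProj_self hv hc]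
            change V.proj (y * 1) (c • v) = c • v
            rw [mul_one]
            exact hv.smul c
          · rw [tensorProj_of_ne hv hc hz, map_zero]
            rw [mul_one] at hz
            exact (hv.smul c).proj_of_ne hz
        exact LinearMap.congr_fun key t }
  inv :=
    { lin := (TensorProduct.rid ℂ V).symm.toLinearMap
      comm := fun z t => by
        have key : tensorProj V (line ω 1) z ∘ₗ (TensorProduct.rid ℂ V).symm.toLinearMap =
            (TensorProduct.rid ℂ V).symm.toLinearMap ∘ₗ V.proj z := by
          apply V.lin_ext
          intro y v hv
          have hc := line_isHomog (ω := ω) 1 1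
          change tensorProj V (line ω 1) z (v ⊗ₜ (1 : ℂ)) = (V.proj z v) ⊗ₜ (1 : ℂ)
          by_cases hz : z = y * 1
          · subst hz
            rw [tensorProj_self hv hc, mul_one, hv]
          · rw [tensorProj_of_ne hv hc hz]
            rw [mul_one] at hz
            rw [hv.proj_of_ne hz, TensorProduct.zero_tmul]
        exact LinearMap.congr_fun key t }
  hom_inv_id := by
    apply hom_ext
    apply LinearMap.ext
    intro t
    exact (TensorProduct.rid ℂ V).symm_apply_apply t
  inv_hom_id := by
    apply hom_ext
    apply LinearMap.ext
    intro t
    exact (TensorProduct.rid ℂ V).apply_symm_apply t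

instance : MonoidalCategoryStruct (VectG ω) where
  tensorObj := tensor
  tensorHom := tensorMap
  whiskerLeft V _ _ f := tensorMap (𝟙 V) f
  whiskerRight f V := tensorMap f (𝟙 V)
  tensorUnit := line ω 1
  associator := assoc
  leftUnitor := leftUnit
  rightUnitor := rightUnit

/-- The monoidal category `Vect_G^ω`. -/
instance : MonoidalCategory (VectG ω) := MonoidalCategory.ofTensorHom
  (id_tensorHom_id := fun V W => by
    apply hom_ext
    exact TensorProduct.map_id)
  (id_tensorHom := fun _ _ _ _ => rfl)
  (tensorHom_id := fun _ _ => rfl)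
  (tensorHom_comp_tensorHom := fun f₁ f₂ g₁ g₂ => by
    apply hom_ext
    exact (TensorProduct.map_comp g₁.lin g₂.lin f₁.lin f₂.lin).symm)
  (associator_naturality := fun {U V W U' V' W'} f g h => by
    apply hom_ext
    refine lin_ext₃ U V W fun x u y v z w hu hv hw => ?_
    change assocLin U' V' W' ((f.lin u ⊗ₜ g.lin v) ⊗ₜ h.lin w) =
      TensorProduct.map f.lin (TensorProduct.map g.lin h.lin)
        (assocLin U V W ((u ⊗ₜ v) ⊗ₜ w))
    rw [assocLin_tmul (hu.map f) (hv.map g) (hw.map h), assocLin_tmul hu hv hw, map_smul,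
      TensorProduct.map_tmul, TensorProduct.map_tmul])
  (leftUnitor_naturality := fun {V W} f => by
    apply hom_ext
    apply TensorProduct.ext
    apply LinearMap.ext
    intro c
    apply LinearMap.ext
    intro v
    exact (f.lin.map_smul c v).symm)
  (rightUnitor_naturality := fun {V W} f => by
    apply hom_ext
    apply TensorProduct.ext
    apply LinearMap.ext
    intro v
    apply LinearMap.ext
    intro c
    exact (f.lin.map_smul c v).symm)
  (pentagon := fun T U V W => by
    apply hom_ext
    refine lin_ext₄ T U V W fun s t x u y v z w ht hu hv hw => ?_
    change TensorProduct.map LinearMap.id (assocLin U V W) (assocLin T (tensor U V) W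
        (assocLin T U V ((t ⊗ₜ u) ⊗ₜ v) ⊗ₜ w)) =
      assocLin T U (tensor V W) (assocLin (tensor T U) V W (((t ⊗ₜ u) ⊗ₜ v) ⊗ₜ w))
    rw [assocLin_tmul ht hu hv, ← TensorProduct.smul_tmul', map_smul,
      assocLin_tmul ht (hu.tmul hv) hw, map_smul, map_smul, TensorProduct.map_tmul,
      assocLin_tmul hu hv hw, assocLin_tmul (ht.tmul hu) hv hw, map_smul]
    erw [assocLin_tmul ht hu (hv.tmul hw)]
    rw [LinearMap.id_apply, TensorProduct.tmul_smul, smul_smul, smul_smul, smul_smul,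
      ← Units.val_mul, ← Units.val_mul, ← Units.val_mul, ← ω.cocycle s x y z]
    rw [mul_comm (_ * _) (ω.toFun x y z), mul_comm (ω.toFun s x y), ← mul_assoc])
  (triangle := fun V W => by
    apply hom_ext
    refine lin_ext₃ V (line ω 1) W fun x v y c z w hv hc hw => ?_
    change TensorProduct.map LinearMap.id (TensorProduct.lid ℂ W).toLinearMap
        (assocLin V (line ω 1) W ((v ⊗ₜ c) ⊗ₜ w)) =
      (TensorProduct.rid ℂ V (v ⊗ₜ c)) ⊗ₜ w
    rw [assocLin_tmul hv (line_isHomog 1 c) hw, ω.one_middle, Units.val_one, one_smul]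
    exact (TensorProduct.smul_tmul c v w).symm)

instance (V W : VectG ω) : Zero (V ⟶ W) := ⟨⟨0, fun x v => by simp⟩⟩

theorem zero_lin (V W : VectG ω) : (0 : V ⟶ W).lin = 0 := rfl

end VectG

section Center

variable {G : Type u} [Group G] [Fintype G] {ω : NormalizedThreeCocycle G}

instance (V W : Center (VectG ω)) : Zero (V ⟶ W) where
  zero :=
    { f := 0
      comm := fun U => by
        apply VectG.hom_ext
        change (W.2.β U).hom.lin ∘ₗ TensorProduct.map 0 LinearMap.id =
          TensorProduct.map LinearMap.id 0 ∘ₗ (V.2.β U).hom.lin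
        rw [TensorProduct.map_zero_left, TensorProduct.map_zero_right, LinearMap.comp_zero,
          LinearMap.zero_comp] }

instance : Limits.HasZeroMorphisms (Center (VectG ω)) where
  comp_zero f Z := by
    apply Center.ext
    apply VectG.hom_ext
    exact LinearMap.zero_comp f.f.lin
  zero_comp X {Y Z} f := by
    apply Center.ext
    apply VectG.hom_ext
    exact LinearMap.comp_zero f.f.lin

/-- The operator `x ▷ -` on an object `W` of the Drinfeld center, determined by the half-braiding
`σ : V ⊗ W → W ⊗ V`, `v ⊗ w ↦ (|v| ▷ w) ⊗ v`, evaluated on the one-dimensional space `V = ℂ` in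
degree `x`. Mathlib's half-braidings go in the direction `W ⊗ V → V ⊗ W`, so `σ` is the inverse
of Mathlib's half-braiding. -/
def centerAct (W : Center (VectG ω)) (x : G) : (W.1 : Type) →ₗ[ℂ] (W.1 : Type) :=
  (TensorProduct.rid ℂ W.1).toLinearMap ∘ₗ (W.2.β (VectG.line ω x)).inv.lin ∘ₗ
    TensorProduct.mk ℂ ℂ W.1 1

/-- `W` is a simple object of the Drinfeld center of `Vect_G^ω` with parameters `(g, χ)`: the
degrees of its nonzero homogeneous components form the conjugacy class of `g`, and `χ` is the
projective character of the centralizer of `g` on `W_g`. For `c` in the centralizer, `c ▷ -` maps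
`W_g` to itself; the trace of its restriction to `W_g` is the trace on `W` of its composite with
the projection onto `W_g`. -/
structure IsSimpleWithParams (W : Center (VectG ω)) (g : G)
    (χ : Subgroup.centralizer ({g} : Set G) → ℂ) : Prop where
  simple : Simple W
  support : ∀ x : G, W.1.proj x ≠ 0 ↔ IsConj g x
  character : ∀ c : Subgroup.centralizer ({g} : Set G),
    χ c = LinearMap.trace ℂ W.1 (W.1.proj g ∘ₗ centerAct W (c : G))

end Center

section Borromean

variable {D : Type*} [Category D] [MonoidalCategory D] [BraidedCategory D]

/-- The braid `σ₂⁻¹ σ₁` on three strands: first `σ` on the two left strands, then `σ⁻¹` on the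
two right strands. -/
def borromeanStep (X Y Z : D) : (X ⊗ Y) ⊗ Z ⟶ (Y ⊗ Z) ⊗ X :=
  (BraidedCategory.braiding X Y).hom ▷ Z ≫ (α_ Y X Z).hom ≫
    Y ◁ (BraidedCategory.braiding Z X).inv ≫ (α_ Y Z X).inv

/-- The braid `(σ₂⁻¹ σ₁)³`, whose closure is the Borromean link. -/
def borromeanBraid (X Y Z : D) : (X ⊗ Y) ⊗ Z ⟶ (X ⊗ Y) ⊗ Z :=
  borromeanStep X Y Z ≫ borromeanStep Y Z X ≫ borromeanStep Z X Y

end Borromean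

/-- The Borromean tensor of the Drinfeld center of `Vect_G^ω`. The braiding is
`σ : V ⊗ W → W ⊗ V`, `v ⊗ w ↦ (|v| ▷ w) ⊗ v`, which is the reverse of Mathlib's braiding of the
center. For the canonical pivotal structure (pivotal dimensions are vector space dimensions) the
pivotal trace is the trace of the underlying linear map. -/
def borromeanTensor {G : Type u} [Group G] [Fintype G] {ω : NormalizedThreeCocycle G}
    (U V W : Center (VectG ω)) : ℂ :=
  LinearMap.trace ℂ ((U ⊗ V) ⊗ W).1
    (@borromeanBraid _ _ _ (reverseBraiding (Center (VectG ω))) U V W).f.lin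

/-- The orbit `g^Q` of `g` under conjugation by elements of `Q`. -/
def conjOrbit {G : Type u} [Group G] (Q : Subgroup G) (g : G) : Set G :=
  {x | ∃ q ∈ Q, q * g * q⁻¹ = x}

section Commutators

variable {G : Type u} [Group G] {A : Subgroup G} [hN : A.Normal]

/-- For `a, b` in the abelian normal subgroup `A`, the element `q ▷ [a, k]` centralizes `b`. -/
theorem conj_commutator_mem (hA : ∀ a ∈ A, ∀ b ∈ A, a * b = b * a) {a b : G} (ha : a ∈ A)
    (hb : b ∈ A) (k q : G) : q * ⁅a, k⁆ * q⁻¹ ∈ Subgroup.centralizer ({b} : Set G) := by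
  have h : ⁅a, k⁆ ∈ A := by
    rw [commutatorElement_def, mul_assoc, mul_assoc, ← mul_assoc k]
    exact A.mul_mem ha (hN.conj_mem _ (A.inv_mem ha) k)
  rw [Subgroup.mem_centralizer_singleton_iff]
  exact hA _ (hN.conj_mem _ h q) b hb

/-- For `a, b` in the abelian normal subgroup `A`, the element `q⁻¹ ▷ [k⁻¹, a⁻¹]` centralizes
`b`. -/
theorem conj_commutator_mem' (hA : ∀ a ∈ A, ∀ b ∈ A, a * b = b * a) {a b : G} (ha : a ∈ A)
    (hb : b ∈ A) (k q : G) :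
    q⁻¹ * ⁅k⁻¹, a⁻¹⁆ * q ∈ Subgroup.centralizer ({b} : Set G) := by
  have h : ⁅k⁻¹, a⁻¹⁆ ∈ A := by
    rw [commutatorElement_def, inv_inv, inv_inv]
    refine A.mul_mem ?_ ha
    simpa using hN.conj_mem _ (A.inv_mem ha) k⁻¹
  rw [Subgroup.mem_centralizer_singleton_iff]
  refine hA _ ?_ b hb
  simpa using hN.conj_mem _ h q⁻¹

end Commutators

end

/-!
Write `x ▷ w` for `centerAct W x w` and `|v|` for the degree of a homogeneous vector `v`. By
naturality the half-braiding `σ : V ⊗ W → W ⊗ V` is `v ⊗ w ↦ (|v| ▷ w) ⊗ v` on all homogeneous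
vectors (`halfBraid_tmul`), so the braid `(σ₂⁻¹ σ₁)³` can be evaluated on homogeneous tensors.

Since `ω` is normalized and inflated from `G ⧸ A`, it is `1` as soon as one argument lies in `A`.
The objects `U` and `V` are concentrated in degrees in `A`. Hence `▷` is an honest linear action
of `G` on them (`centerAct_centerAct_of_mem`), and all associators in the braid are trivial. The
braid is therefore
`(u ⊗ v) ⊗ w ↦ (([|v|, |w|] ▷ u) ⊗ ([|w|⁻¹, |u|⁻¹] ▷ v)) ⊗ w` (`borromeanLin_tmul`), and its trace
is the sum over `a, b, c` of
`tr([b, c] ▷ - | U_a) * tr([c⁻¹, a⁻¹] ▷ - | V_b) * dim W_c` (`borromeanTensor_eq_sum`).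

The summand vanishes outside the conjugacy classes of `g, h, k` and is invariant under
simultaneous conjugation. Conjugating `c` to `k` gives the factor `|k̄|`; parametrizing the other
two classes by `Q`, which fixes `k`, gives a double sum over `p, r ∈ Q` whose terms depend only on
`p⁻¹ r`, and this is `|Q|` times a single sum over `Q` (`card_mul_sum_eq`).
-/

noncomputable section

/-! ### Cocycles trivial on a subgroup -/

section

variable {G : Type u} [Group G] {ω : NormalizedThreeCocycle G}

/-- The cocycle `ω` takes the value `1` as soon as one of its arguments lies in `A`. Cocycles
inflated from normalized cocycles of `G ⧸ A` have this property. -/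
def NormalizedThreeCocycle.TrivialOn (ω : NormalizedThreeCocycle G) (A : Subgroup G) : Prop :=
  ∀ x y z : G, x ∈ A ∨ y ∈ A ∨ z ∈ A → ω.toFun x y z = 1

theorem NormalizedThreeCocycle.trivialOn_inflate {A : Subgroup G} [A.Normal]
    (ω : NormalizedThreeCocycle (G ⧸ A)) : ω.inflate.TrivialOn A := by
  rintro x y z (h | h | h)
  · change ω.toFun (x : G ⧸ A) y z = 1
    rw [(QuotientGroup.eq_one_iff x).2 h, ω.one_left]
  · change ω.toFun (x : G ⧸ A) y z = 1
    rw [(QuotientGroup.eq_one_iff y).2 h, ω.one_middle]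
  · change ω.toFun (x : G ⧸ A) y z = 1
    rw [(QuotientGroup.eq_one_iff z).2 h, ω.one_right]

end

/-! ### The half-braiding and the operators `x ▷ -` -/

section

variable {G : Type u} [Group G] [Fintype G] {ω : NormalizedThreeCocycle G}

/-- The half-braiding `σ : V ⊗ W → W ⊗ V` of an object `W` of the center, as a linear map. -/
def halfBraid (W : Center (VectG ω)) (V : VectG ω) :
    (V : Type) ⊗[ℂ] (W.1 : Type) →ₗ[ℂ] (W.1 : Type) ⊗[ℂ] (V : Type) :=
  (W.2.β V).inv.lin

/-- The inverse of the half-braiding `σ : V ⊗ W → W ⊗ V`, as a linear map. -/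
def halfBraidInv (W : Center (VectG ω)) (V : VectG ω) :
    (W.1 : Type) ⊗[ℂ] (V : Type) →ₗ[ℂ] (V : Type) ⊗[ℂ] (W.1 : Type) :=
  (W.2.β V).hom.lin

theorem halfBraid_halfBraidInv (W : Center (VectG ω)) (V : VectG ω)
    (t : (W.1 : Type) ⊗[ℂ] (V : Type)) : halfBraid W V (halfBraidInv W V t) = t :=
  LinearMap.congr_fun (congrArg VectG.Hom.lin (W.2.β V).hom_inv_id) t

theorem halfBraidInv_halfBraid (W : Center (VectG ω)) (V : VectG ω)
    (t : (V : Type) ⊗[ℂ] (W.1 : Type)) : halfBraidInv W V (halfBraid W V t) = t :=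
  LinearMap.congr_fun (congrArg VectG.Hom.lin (W.2.β V).inv_hom_id) t

theorem halfBraid_natural (W : Center (VectG ω)) {V V' : VectG ω} (f : V ⟶ V')
    (t : (V : Type) ⊗[ℂ] (W.1 : Type)) :
    halfBraid W V' (TensorProduct.map f.lin LinearMap.id t) =
      TensorProduct.map LinearMap.id f.lin (halfBraid W V t) := by
  have h : f ▷ W.1 ≫ (W.2.β V').inv = (W.2.β V).inv ≫ W.1 ◁ f := by
    rw [Iso.comp_inv_eq, Category.assoc, W.2.naturality, Iso.inv_hom_id_assoc]
  exact LinearMap.congr_fun (congrArg VectG.Hom.lin h) t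

/-- A homogeneous vector of degree `x`, seen as a morphism from the line in degree `x`. -/
def VectG.homOfHomog {V : VectG ω} {x : G} {v : V} (hv : V.IsHomog x v) :
    VectG.line ω x ⟶ V where
  lin := LinearMap.toSpanSingleton ℂ V v
  comm y c := by
    have hc := VectG.line_isHomog (ω := ω) x c
    by_cases hy : y = x
    · subst hy
      rw [hc]
      exact hv.smul c
    · rw [hc.proj_of_ne hy, map_zero]
      exact (hv.smul c).proj_of_ne hy

theorem halfBraid_line (W : Center (VectG ω)) (x : G) (w : W.1) :
    halfBraid W (VectG.line ω x) ((1 : ℂ) ⊗ₜ w) = centerAct W x w ⊗ₜ (1 : ℂ) :=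
  ((TensorProduct.rid ℂ W.1).symm_apply_apply
    (halfBraid W (VectG.line ω x) ((1 : ℂ) ⊗ₜ w))).symm

/-- The half-braiding is `v ⊗ w ↦ (|v| ▷ w) ⊗ v`: naturality reduces to the case in which `v` is
the generator of the line in degree `|v|`. -/
theorem halfBraid_tmul (W : Center (VectG ω)) {V : VectG ω} {x : G} {v : V}
    (hv : V.IsHomog x v) (w : W.1) :
    halfBraid W V (v ⊗ₜ w) = centerAct W x w ⊗ₜ v := by
  have h := halfBraid_natural W (VectG.homOfHomog hv) ((1 : ℂ) ⊗ₜ w)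
  rw [halfBraid_line] at h
  have e : (VectG.homOfHomog hv).lin (1 : ℂ) = v := one_smul ℂ v
  rw [TensorProduct.map_tmul, TensorProduct.map_tmul] at h
  rw [e] at h
  exact h

theorem halfBraidInv_tmul (W : Center (VectG ω)) {V : VectG ω} {x : G} {v : V}
    (hv : V.IsHomog x v) (w : W.1) :
    halfBraidInv W V (centerAct W x w ⊗ₜ v) = v ⊗ₜ w := by
  rw [← halfBraid_tmul W hv, halfBraidInv_halfBraid]

theorem centerAct_injective (W : Center (VectG ω)) (x : G) :
    Function.Injective (centerAct W x) := by
  intro w w' h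
  have hc := VectG.line_isHomog (ω := ω) x (1 : ℂ)
  have h1 := halfBraidInv_tmul W hc w
  rw [h, halfBraidInv_tmul W hc w'] at h1
  have h2 := congrArg (TensorProduct.lid ℂ W.1) h1
  have e1 := TensorProduct.lid_tmul (R := ℂ) w (1 : ℂ)
  have e2 := TensorProduct.lid_tmul (R := ℂ) w' (1 : ℂ)
  rw [one_smul] at e1 e2
  exact e1.symm.trans (h2.symm.trans e2)

theorem VectG.tensorProj_tmul_right {V W : VectG ω} {x : G} {w : W} (hw : W.IsHomog x w) (z : G)
    (v : V) : VectG.tensorProj V W z (v ⊗ₜ w) = V.proj (z * x⁻¹) v ⊗ₜ w := by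
  unfold VectG.tensorProj
  rw [LinearMap.sum_apply, Finset.sum_eq_single (z * x⁻¹)]
  · rw [TensorProduct.map_tmul, show (z * x⁻¹)⁻¹ * z = x by group, hw]
  · intro a _ ha
    rw [TensorProduct.map_tmul, hw.proj_of_ne, TensorProduct.tmul_zero]
    rintro rfl
    exact ha (by group)
  · intro h
    exact absurd (Finset.mem_univ _) h

theorem isHomog_centerAct (W : Center (VectG ω)) (x : G) {y : G} {w : W.1}
    (hw : W.1.IsHomog y w) : W.1.IsHomog (x * y * x⁻¹) (centerAct W x w) := by
  have hc := VectG.line_isHomog (ω := ω) x (1 : ℂ)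
  have h1 : VectG.tensorProj W.1 (VectG.line ω x) (x * y)
      (halfBraid W (VectG.line ω x) ((1 : ℂ) ⊗ₜ w)) =
      halfBraid W (VectG.line ω x) ((1 : ℂ) ⊗ₜ w) :=
    (hc.tmul hw).map (W.2.β (VectG.line ω x)).inv
  rw [halfBraid_line, VectG.tensorProj_tmul_right hc] at h1
  have h2 := congrArg (TensorProduct.rid ℂ W.1) h1
  have e1 := TensorProduct.rid_tmul (R := ℂ) (centerAct W x w) (1 : ℂ)
  have e2 := TensorProduct.rid_tmul (R := ℂ) (W.1.proj (x * y * x⁻¹) (centerAct W x w)) (1 : ℂ)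
  rw [one_smul] at e1 e2
  exact e2.symm.trans (h2.trans e1)

theorem halfBraidInv_tensor (W : Center (VectG ω)) (U V : VectG ω)
    (t : (W.1 : Type) ⊗[ℂ] ((U : Type) ⊗[ℂ] (V : Type))) :
    halfBraidInv W (VectG.tensor U V) t =
      VectG.assocInvLin U V W.1 (TensorProduct.map LinearMap.id (halfBraidInv W V)
        (VectG.assocLin U W.1 V (TensorProduct.map (halfBraidInv W U) LinearMap.id
          (VectG.assocInvLin W.1 U V t)))) :=
  LinearMap.congr_fun (congrArg VectG.Hom.lin (W.2.monoidal U V)) t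

/-- `x ▷ (y ▷ w) = (x y) ▷ w` as soon as the three values of the cocycle in the hexagon for the
half-braiding are trivial. -/
theorem centerAct_centerAct (W : Center (VectG ω)) {x y z : G} {w : W.1} (hw : W.1.IsHomog z w)
    (h₁ : ω.toFun x y z = 1) (h₂ : ω.toFun x (y * z * y⁻¹) y = 1)
    (h₃ : ω.toFun (x * (y * z * y⁻¹) * x⁻¹) x y = 1) :
    centerAct W x (centerAct W y w) = centerAct W (x * y) w := by
  have hx := VectG.line_isHomog (ω := ω) x (1 : ℂ)
  have hy := VectG.line_isHomog (ω := ω) y (1 : ℂ)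
  have hyw := isHomog_centerAct W y hw
  have hxyw := isHomog_centerAct W x hyw
  -- Both vectors are carried to `(1 ⊗ 1) ⊗ w`: one directly, the other one strand at a time.
  have key : halfBraidInv W (VectG.tensor (VectG.line ω x) (VectG.line ω y))
      (centerAct W x (centerAct W y w) ⊗ₜ ((1 : ℂ) ⊗ₜ (1 : ℂ))) =
      halfBraidInv W (VectG.tensor (VectG.line ω x) (VectG.line ω y))
      (centerAct W (x * y) w ⊗ₜ ((1 : ℂ) ⊗ₜ (1 : ℂ))) := by
    rw [halfBraidInv_tmul W (hx.tmul hy)]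
    rw [halfBraidInv_tensor, VectG.assocInvLin_tmul hxyw hx hy, h₃, inv_one, Units.val_one,
      one_smul, TensorProduct.map_tmul, halfBraidInv_tmul W hx, LinearMap.id_apply,
      VectG.assocLin_tmul hx hyw hy, h₂, Units.val_one, one_smul, TensorProduct.map_tmul,
      halfBraidInv_tmul W hy, LinearMap.id_apply, VectG.assocInvLin_tmul hx hy hw, h₁, inv_one,
      Units.val_one, one_smul]
  have h := congrArg (halfBraid W _) key
  rw [halfBraid_halfBraidInv, halfBraid_halfBraidInv] at h
  have h' := congrArg (fun t => TensorProduct.rid ℂ W.1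
    (TensorProduct.map LinearMap.id (TensorProduct.lid ℂ ℂ).toLinearMap t)) h
  have e (u : W.1) : TensorProduct.rid ℂ W.1
      (TensorProduct.map LinearMap.id (TensorProduct.lid ℂ ℂ).toLinearMap
        (u ⊗ₜ ((1 : ℂ) ⊗ₜ[ℂ] (1 : ℂ)))) = u := by
    simp
  exact (e _).symm.trans (h'.trans (e _))

/-- The operator `1 ▷ -` is idempotent, since the cocycle is normalized, and injective. -/
theorem centerAct_one (W : Center (VectG ω)) : centerAct W 1 = LinearMap.id := by
  refine W.1.lin_ext fun z w hw => centerAct_injective W 1 ?_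
  rw [centerAct_centerAct W hw (ω.one_left _ _) (ω.one_left _ _) (ω.one_middle _ _), mul_one]
  rfl

/-! ### The Borromean braid -/

/-- One step of the braid, `(x ⊗ y) ⊗ z ↦ ((|x| ▷ y) ⊗ z) ⊗ (|z| ▷ -)⁻¹ x` up to the two
associators, as a linear map. -/
def borromeanStepLin (X Y Z : Center (VectG ω)) :
    ((X.1 : Type) ⊗[ℂ] (Y.1 : Type)) ⊗[ℂ] (Z.1 : Type) →ₗ[ℂ]
      ((Y.1 : Type) ⊗[ℂ] (Z.1 : Type)) ⊗[ℂ] (X.1 : Type) :=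
  VectG.assocInvLin Y.1 Z.1 X.1 ∘ₗ TensorProduct.map LinearMap.id (halfBraidInv X Z.1) ∘ₗ
    VectG.assocLin Y.1 X.1 Z.1 ∘ₗ TensorProduct.map (halfBraid Y X.1) LinearMap.id

theorem borromeanStep_lin (X Y Z : Center (VectG ω)) :
    (@borromeanStep _ _ _ (reverseBraiding (Center (VectG ω))) X Y Z).f.lin =
      borromeanStepLin X Y Z := by
  have h₁ : (α_ Y Z X).inv.f.lin = VectG.assocInvLin Y.1 Z.1 X.1 := by
    rw [Center.associator_inv_f]
    rfl
  have h₂ : (β_ Y X).inv.f.lin = halfBraid Y X.1 := by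
    have h : (β_ Y X).inv.f = (Y.2.β X.1).inv := IsIso.Iso.inv_hom _
    rw [h]
    rfl
  unfold borromeanStepLin
  rw [← h₁, ← h₂]
  rfl

/-- The operator whose trace is the Borromean tensor. -/
def borromeanLin (U V W : Center (VectG ω)) :
    ((U.1 : Type) ⊗[ℂ] (V.1 : Type)) ⊗[ℂ] (W.1 : Type) →ₗ[ℂ]
      ((U.1 : Type) ⊗[ℂ] (V.1 : Type)) ⊗[ℂ] (W.1 : Type) :=
  borromeanStepLin W U V ∘ₗ borromeanStepLin V W U ∘ₗ borromeanStepLin U V W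

theorem borromeanTensor_eq_trace (U V W : Center (VectG ω)) :
    borromeanTensor U V W = LinearMap.trace ℂ _ (borromeanLin U V W) := by
  unfold borromeanLin
  rw [← borromeanStep_lin, ← borromeanStep_lin, ← borromeanStep_lin]
  rfl

theorem borromeanStepLin_tmul (X Y Z : Center (VectG ω)) {a b c : G} {x : X.1} {y : Y.1}
    {z : Z.1} (hx : X.1.IsHomog a x) (hy : Y.1.IsHomog b y) (hz : Z.1.IsHomog c z)
    (h₁ : ω.toFun ((c * a * c⁻¹) * b * (c * a * c⁻¹)⁻¹) (c * a * c⁻¹) c = 1)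
    (h₂ : ω.toFun ((c * a * c⁻¹) * b * (c * a * c⁻¹)⁻¹) c a = 1) :
    borromeanStepLin X Y Z ((centerAct X c x ⊗ₜ y) ⊗ₜ z) =
      (centerAct Y (c * a * c⁻¹) y ⊗ₜ z) ⊗ₜ x := by
  have hcx := isHomog_centerAct X c hx
  have hy' := isHomog_centerAct Y (c * a * c⁻¹) hy
  unfold borromeanStepLin
  rw [LinearMap.comp_apply, LinearMap.comp_apply, LinearMap.comp_apply, TensorProduct.map_tmul,
    halfBraid_tmul Y hcx, LinearMap.id_apply, VectG.assocLin_tmul hy' hcx hz, h₁, Units.val_one,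
    one_smul, TensorProduct.map_tmul, halfBraidInv_tmul X hz, LinearMap.id_apply,
    VectG.assocInvLin_tmul hy' hz hx, h₂, inv_one, Units.val_one, one_smul]

section TrivialOn

variable {A : Subgroup G} [hN : A.Normal]

theorem centerAct_centerAct_of_mem (hω : ω.TrivialOn A) (W : Center (VectG ω)) (x y : G) {z : G}
    (hz : z ∈ A) {w : W.1} (hw : W.1.IsHomog z w) :
    centerAct W x (centerAct W y w) = centerAct W (x * y) w := by
  have hy : y * z * y⁻¹ ∈ A := hN.conj_mem _ hz _
  exact centerAct_centerAct W hw (hω _ _ _ (.inr (.inr hz))) (hω _ _ _ (.inr (.inl hy)))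
    (hω _ _ _ (.inl (hN.conj_mem _ hy _)))

/-- On homogeneous vectors of degrees `a, b, c` with `a, b ∈ A` all associators occurring in the
braid are trivial. The strands of `U` and `V` are acted on by commutators, the strand of `W` is
carried to itself. -/
theorem borromeanLin_tmul (hA : ∀ a ∈ A, ∀ b ∈ A, a * b = b * a) (hω : ω.TrivialOn A)
    (U V W : Center (VectG ω)) {a b c : G} (ha : a ∈ A) (hb : b ∈ A) {x : U.1} {y : V.1} {z : W.1}
    (hx : U.1.IsHomog a x) (hy : V.1.IsHomog b y) (hz : W.1.IsHomog c z) :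
    borromeanLin U V W ((x ⊗ₜ y) ⊗ₜ z) =
      (centerAct U ⁅b, c⁆ x ⊗ₜ centerAct V ⁅c⁻¹, a⁻¹⁆ y) ⊗ₜ z := by
  obtain ⟨a', ha', rfl⟩ : ∃ a', a' ∈ A ∧ c * a' * c⁻¹ = a :=
    ⟨c⁻¹ * a * c, by simpa using hN.conj_mem _ ha c⁻¹, by group⟩
  have hcomm : ∀ d ∈ A, d * b * d⁻¹ = b := fun d hd => by rw [hA d hd b hb, mul_inv_cancel_right]
  -- `x` and the vector that `y` becomes in the first step are images under the operators which
  -- the inverse half-braidings of the first and the second step undo.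
  obtain ⟨x', hx', rfl⟩ : ∃ x', U.1.IsHomog a' x' ∧ centerAct U c x' = x := by
    refine ⟨centerAct U c⁻¹ x, ?_, ?_⟩
    · have h := isHomog_centerAct U c⁻¹ hx
      rwa [show c⁻¹ * (c * a' * c⁻¹) * c⁻¹⁻¹ = a' by group] at h
    · rw [centerAct_centerAct_of_mem hω U _ _ ha hx, mul_inv_cancel, centerAct_one]
      rfl
  have hd : a'⁻¹ * (c * a' * c⁻¹) ∈ A := A.mul_mem (A.inv_mem ha') ha
  obtain ⟨y', hy', hyy, rfl⟩ : ∃ y', V.1.IsHomog b y' ∧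
      centerAct V a' y' = centerAct V (c * a' * c⁻¹) y ∧
      centerAct V (a'⁻¹ * (c * a' * c⁻¹)) y = y' := by
    have h := isHomog_centerAct V (a'⁻¹ * (c * a' * c⁻¹)) hy
    rw [hcomm _ hd] at h
    exact ⟨_, h, by rw [centerAct_centerAct_of_mem hω V _ _ hb hy, mul_inv_cancel_left], rfl⟩
  have hcx := hcomm _ ha
  have hb' := hcomm a' ha'
  have e₁ : borromeanStepLin U V W ((centerAct U c x' ⊗ₜ y) ⊗ₜ z) =
      (centerAct V (c * a' * c⁻¹) y ⊗ₜ z) ⊗ₜ x' :=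
    borromeanStepLin_tmul U V W hx' hy hz (hω _ _ _ (.inr (.inl ha))) (hω _ _ _ (.inr (.inr ha')))
  have e₂ : borromeanStepLin V W U ((centerAct V (c * a' * c⁻¹) y ⊗ₜ z) ⊗ₜ x') =
      (centerAct W b z ⊗ₜ x') ⊗ₜ centerAct V (a'⁻¹ * (c * a' * c⁻¹)) y := by
    rw [← hyy, borromeanStepLin_tmul V W U hy' hz hx' (hω _ _ _ (.inr (.inr ha')))
      (hω _ _ _ (.inr (.inr hb))), hb']
  have e₃ : borromeanStepLin W U V
      ((centerAct W b z ⊗ₜ x') ⊗ₜ centerAct V (a'⁻¹ * (c * a' * c⁻¹)) y) =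
      (centerAct U (b * c * b⁻¹) x' ⊗ₜ centerAct V (a'⁻¹ * (c * a' * c⁻¹)) y) ⊗ₜ z :=
    borromeanStepLin_tmul W U V hz hx' hy' (hω _ _ _ (.inr (.inr hb)))
      (hω _ _ _ (.inr (.inl hb)))
  unfold borromeanLin
  rw [LinearMap.comp_apply, LinearMap.comp_apply, e₁, e₂, e₃,
    centerAct_centerAct_of_mem hω U _ _ ha' hx', commutatorElement_def, commutatorElement_def]
  congr 4
  · group
  · group

/-- The trace of `x ▷ -` on the homogeneous component of degree `a`; when `x` does not centralize
`a` it is the trace of the diagonal block, which is `0`. -/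
def componentTrace (W : Center (VectG ω)) (a x : G) : ℂ :=
  LinearMap.trace ℂ W.1 (W.1.proj a ∘ₗ centerAct W x)

theorem borromeanTensor_eq_sum (hA : ∀ a ∈ A, ∀ b ∈ A, a * b = b * a) (hω : ω.TrivialOn A)
    (U V W : Center (VectG ω)) (hU : ∀ a ∉ A, U.1.proj a = 0) (hV : ∀ b ∉ A, V.1.proj b = 0) :
    borromeanTensor U V W = ∑ a, ∑ b, ∑ c, componentTrace U a ⁅b, c⁆ *
      componentTrace V b ⁅c⁻¹, a⁻¹⁆ * componentTrace W c 1 := by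
  have key : borromeanLin U V W = ∑ a, ∑ b, ∑ c, TensorProduct.map
      (TensorProduct.map (centerAct U ⁅b, c⁆ ∘ₗ U.1.proj a) (centerAct V ⁅c⁻¹, a⁻¹⁆ ∘ₗ V.1.proj b))
      (W.1.proj c) := by
    refine VectG.lin_ext₃ U.1 V.1 W.1 fun a x b y c z hx hy hz => ?_
    by_cases ha : a ∈ A
    swap
    · rw [← hx, hU a ha]
      simp
    by_cases hb : b ∈ A
    swap
    · rw [← hy, hV b hb]
      simp
    rw [borromeanLin_tmul hA hω U V W ha hb hx hy hz]
    simp only [LinearMap.sum_apply, TensorProduct.map_tmul, LinearMap.comp_apply]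
    rw [Finset.sum_eq_single a, Finset.sum_eq_single b, Finset.sum_eq_single c, hx, hy, hz]
    · intro c' _ hc'
      simp [hz.proj_of_ne hc']
    · simp
    · intro b' _ hb'
      simp [hy.proj_of_ne hb']
    · simp
    · intro a' _ ha'
      simp [hx.proj_of_ne ha']
    · simp
  rw [borromeanTensor_eq_trace, key]
  simp only [map_sum, LinearMap.trace_tensorProduct', componentTrace, centerAct_one,
    LinearMap.comp_id]
  refine Finset.sum_congr rfl fun a _ => Finset.sum_congr rfl fun b _ =>
    Finset.sum_congr rfl fun c _ => ?_
  rw [LinearMap.trace_comp_comm', LinearMap.trace_comp_comm' (V.1.proj b)]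

end TrivialOn

/-! ### Traces on homogeneous components -/

theorem centerAct_proj (W : Center (VectG ω)) (p a : G) (w : W.1) :
    centerAct W p (W.1.proj a w) = W.1.proj (p * a * p⁻¹) (centerAct W p w) := by
  change (centerAct W p ∘ₗ W.1.proj a) w = (W.1.proj (p * a * p⁻¹) ∘ₗ centerAct W p) w
  congr 1
  refine W.1.lin_ext fun z w hw => ?_
  have hpw := isHomog_centerAct W p hw
  rw [LinearMap.comp_apply, LinearMap.comp_apply]
  by_cases h : a = z
  · subst h
    rw [hw, hpw]
  · rw [hw.proj_of_ne h, hpw.proj_of_ne (by simpa using h), map_zero]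

/-- Conjugating by the invertible operator `p ▷ -`. -/
theorem componentTrace_eq_of_comp_eq (W : Center (VectG ω)) (p a : G) {x y : G}
    (h : ∀ w, centerAct W y (centerAct W p w) = centerAct W p (centerAct W x w)) :
    componentTrace W (p * a * p⁻¹) y = componentTrace W a x := by
  let e := LinearEquiv.ofInjectiveEndo (centerAct W p) (centerAct_injective W p)
  unfold componentTrace
  rw [← LinearMap.trace_conj' (W.1.proj a ∘ₗ centerAct W x) e]
  congr 1
  ext w
  obtain ⟨w, rfl⟩ := e.surjective w
  rw [LinearEquiv.conj_apply_apply, e.symm_apply_apply]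
  change W.1.proj _ (centerAct W y (centerAct W p w)) = centerAct W p (W.1.proj a (centerAct W x w))
  rw [h, centerAct_proj]

theorem componentTrace_conj_one (W : Center (VectG ω)) (p a : G) :
    componentTrace W (p * a * p⁻¹) 1 = componentTrace W a 1 :=
  componentTrace_eq_of_comp_eq W p a fun w => by rw [centerAct_one]; rfl

theorem componentTrace_conj {A : Subgroup G} [A.Normal] (hω : ω.TrivialOn A)
    (W : Center (VectG ω)) (hW : ∀ a ∉ A, W.1.proj a = 0) (p a x : G) :
    componentTrace W (p * a * p⁻¹) (p * x * p⁻¹) = componentTrace W a x := by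
  refine componentTrace_eq_of_comp_eq W p a fun w => ?_
  change (centerAct W (p * x * p⁻¹) ∘ₗ centerAct W p) w = (centerAct W p ∘ₗ centerAct W x) w
  congr 1
  refine W.1.lin_ext fun z w hw => ?_
  by_cases hz : z ∈ A
  · rw [LinearMap.comp_apply, LinearMap.comp_apply, centerAct_centerAct_of_mem hω W _ _ hz hw,
      centerAct_centerAct_of_mem hω W _ _ hz hw, inv_mul_cancel_right]
  · rw [← hw, hW z hz, LinearMap.zero_apply, map_zero, map_zero]

theorem componentTrace_of_proj_eq_zero {W : Center (VectG ω)} {a : G} (h : W.1.proj a = 0)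
    (x : G) : componentTrace W a x = 0 := by
  unfold componentTrace
  rw [h, LinearMap.zero_comp, map_zero]

theorem IsSimpleWithParams.proj_eq_zero {W : Center (VectG ω)} {g : G}
    {χ : Subgroup.centralizer ({g} : Set G) → ℂ} (hW : IsSimpleWithParams W g χ) {a : G}
    (h : ¬ IsConj g a) : W.1.proj a = 0 :=
  not_not.1 fun h' => h ((hW.support a).1 h')

theorem IsSimpleWithParams.proj_eq_zero_of_notMem {A : Subgroup G} [hN : A.Normal]
    {W : Center (VectG ω)} {g : G} {χ : Subgroup.centralizer ({g} : Set G) → ℂ}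
    (hW : IsSimpleWithParams W g χ) (hg : g ∈ A) (a : G) (ha : a ∉ A) : W.1.proj a = 0 := by
  refine hW.proj_eq_zero fun h => ha ?_
  obtain ⟨c, rfl⟩ := isConj_iff.1 h
  exact hN.conj_mem g hg c

end

/-! ### Sums over conjugacy classes and `Q`-orbits -/

section

variable {G : Type u} [Group G]

/-- The factor in `A` of an element of `G = A Q` acts trivially on the abelian group `A`. -/
theorem conjOrbit_eq_conjugatesOf_of_isComplement' {A Q : Subgroup G} [hN : A.Normal]
    (hA : ∀ a ∈ A, ∀ b ∈ A, a * b = b * a) (hQ : A.IsComplement' Q) {g : G} (hg : g ∈ A) :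
    conjOrbit Q g = conjugatesOf g := by
  ext x
  constructor
  · rintro ⟨q, -, rfl⟩
    exact isConj_iff.2 ⟨q, rfl⟩
  · intro hx
    obtain ⟨c, rfl⟩ := isConj_iff.1 hx
    obtain ⟨⟨⟨a, ha⟩, ⟨q, hq⟩⟩, rfl⟩ := hQ.2 c
    refine ⟨q, hq, ?_⟩
    have h := hA a ha _ (hN.conj_mem g hg q)
    calc q * g * q⁻¹ = a * (q * g * q⁻¹) * a⁻¹ := by rw [h, mul_inv_cancel_right]
      _ = a * q * g * (a * q)⁻¹ := by group

variable [Fintype G]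

/-- Sum over a conjugacy class which is a single `Q`-orbit: each element is hit by as many elements
of `Q` as there are in the stabilizer of `g`. -/
theorem sum_conj_eq_card_mul_sum (Q : Subgroup G) [Fintype Q] {g : G}
    (hQ : conjOrbit Q g = conjugatesOf g) (f : G → ℂ) (hf : ∀ a, ¬ IsConj g a → f a = 0) :
    ∑ p : Q, f ((p : G) * g * (p : G)⁻¹) =
      (Nat.card ↥(Q ⊓ Subgroup.centralizer ({g} : Set G)) : ℂ) * ∑ a, f a := by
  classical
  rw [← Finset.sum_fiberwise Finset.univ (fun p : Q => (p : G) * g * (p : G)⁻¹), Finset.mul_sum]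
  refine Finset.sum_congr rfl fun a _ => ?_
  rw [Finset.sum_congr rfl (g := fun _ => f a) fun p hp => by rw [(Finset.mem_filter.1 hp).2],
    Finset.sum_const, nsmul_eq_mul]
  by_cases ha : IsConj g a
  swap
  · rw [hf a ha, mul_zero, mul_zero]
  obtain ⟨r, hr, rfl⟩ : a ∈ conjOrbit Q g := hQ ▸ ha
  congr 2
  have hmem : ∀ p : G, p * g * p⁻¹ = r * g * r⁻¹ ↔
      r⁻¹ * p ∈ Subgroup.centralizer ({g} : Set G) := fun p => by
    rw [Subgroup.mem_centralizer_singleton_iff, mul_inv_eq_iff_eq_mul, mul_assoc r⁻¹,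
      inv_mul_eq_iff_eq_mul, ← mul_assoc, ← mul_assoc]
  let e : {p : Q // (p : G) * g * (p : G)⁻¹ = r * g * r⁻¹} ≃
      ↥(Q ⊓ Subgroup.centralizer ({g} : Set G)) :=
    { toFun := fun p => ⟨r⁻¹ * (p.1 : G), Q.mul_mem (Q.inv_mem hr) p.1.2, (hmem _).1 p.2⟩
      invFun := fun s => ⟨⟨r * (s : G), Q.mul_mem hr s.2.1⟩,
        (hmem _).2 (by rw [inv_mul_cancel_left]; exact s.2.2)⟩
      left_inv := fun p => Subtype.ext (Subtype.ext (mul_inv_cancel_left r (p.1 : G)))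
      right_inv := fun s => Subtype.ext (inv_mul_cancel_left r (s : G)) }
  rw [← Fintype.card_subtype, ← Nat.card_eq_fintype_card]
  exact Nat.card_congr e

theorem sum_eq_ncard_mul {k : G} (f : G → ℂ) (hf : ∀ a, ¬ IsConj k a → f a = 0)
    (hc : ∀ p a, f (p * a * p⁻¹) = f a) : ∑ a, f a = ((conjugatesOf k).ncard : ℂ) * f k := by
  classical
  have hS : conjugatesOf k = (Finset.univ.filter (IsConj k) : Finset G) := by
    ext a
    rw [Finset.mem_coe, Finset.mem_filter_univ]
    rfl
  rw [hS, Set.ncard_coe_finset, ← nsmul_eq_mul, ← Finset.sum_const, Finset.sum_filter]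
  refine Finset.sum_congr rfl fun a _ => ?_
  split_ifs with ha
  · obtain ⟨p, rfl⟩ := isConj_iff.1 ha
    exact hc p k
  · exact hf a ha

theorem sum_conj_eq_sum (p : G) (f : G → ℂ) : ∑ a, f (p * a * p⁻¹) = ∑ a, f a :=
  (MulAut.conj p).toEquiv.sum_comp f

/-- A sum of a conjugation invariant function over three conjugacy classes, reduced to a sum over
`Q` by fixing the third variable at `k` and then the first one at `g`. -/
theorem card_mul_sum_eq (F : G → G → G → ℂ) {g h k : G}
    (hF : ∀ p a b c, F (p * a * p⁻¹) (p * b * p⁻¹) (p * c * p⁻¹) = F a b c)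
    (hg : ∀ a b c, ¬ IsConj g a → F a b c = 0) (hh : ∀ a b c, ¬ IsConj h b → F a b c = 0)
    (hk : ∀ a b c, ¬ IsConj k c → F a b c = 0) (Q : Subgroup G) [Fintype Q]
    (hQ : Q ≤ Subgroup.centralizer ({k} : Set G)) (hQg : conjOrbit Q g = conjugatesOf g)
    (hQh : conjOrbit Q h = conjugatesOf h) :
    (Nat.card ↥(Q ⊓ Subgroup.centralizer ({g} : Set G)) : ℂ) *
        (Nat.card ↥(Q ⊓ Subgroup.centralizer ({h} : Set G)) : ℂ) * ∑ a, ∑ b, ∑ c, F a b c =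
      ((conjugatesOf k).ncard : ℂ) * (Nat.card Q : ℂ) *
        ∑ q : Q, F g ((q : G) * h * (q : G)⁻¹) k := by
  have hsum : ∑ a, ∑ b, ∑ c, F a b c =
      ((conjugatesOf k).ncard : ℂ) * ∑ a, ∑ b, F a b k := by
    rw [Finset.sum_congr rfl fun a _ => Finset.sum_comm, Finset.sum_comm]
    refine sum_eq_ncard_mul (fun c => ∑ a, ∑ b, F a b c) (fun c hc => ?_) (fun p c => ?_)
    · exact Finset.sum_eq_zero fun a _ => Finset.sum_eq_zero fun b _ => hk a b c hc
    · rw [← sum_conj_eq_sum p]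
      refine Finset.sum_congr rfl fun a _ => ?_
      rw [← sum_conj_eq_sum p]
      exact Finset.sum_congr rfl fun b _ => hF p a b c
  have hgh : (Nat.card ↥(Q ⊓ Subgroup.centralizer ({g} : Set G)) : ℂ) *
      (Nat.card ↥(Q ⊓ Subgroup.centralizer ({h} : Set G)) : ℂ) * ∑ a, ∑ b, F a b k =
      ∑ p : Q, ∑ r : Q, F ((p : G) * g * (p : G)⁻¹) ((r : G) * h * (r : G)⁻¹) k := by
    rw [sum_conj_eq_card_mul_sum Q hQg
      (fun a => ∑ r : Q, F a ((r : G) * h * (r : G)⁻¹) k)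
      fun a ha => Finset.sum_eq_zero fun r _ => hg a _ k ha, mul_assoc]
    congr 1
    rw [Finset.mul_sum]
    refine Finset.sum_congr rfl fun a _ => ?_
    exact (sum_conj_eq_card_mul_sum Q hQh (fun b => F a b k) fun b hb => hh a b k hb).symm
  rw [hsum, mul_left_comm, hgh, mul_assoc]
  congr 1
  -- Conjugating all three arguments by `p⁻¹`, which fixes `k`, replaces `r` by `q = p⁻¹ r`.
  have hp : ∀ p : Q, ∑ r : Q, F ((p : G) * g * (p : G)⁻¹) ((r : G) * h * (r : G)⁻¹) k =
      ∑ q : Q, F g ((q : G) * h * (q : G)⁻¹) k := fun p => by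
    rw [← Equiv.sum_comp (Equiv.mulLeft p)]
    refine Finset.sum_congr rfl fun q _ => ?_
    rw [← hF p g _ k]
    have hpk : (p : G) * k * (p : G)⁻¹ = k := by
      rw [Subgroup.mem_centralizer_singleton_iff.1 (hQ p.2), mul_inv_cancel_right]
    rw [hpk]
    congr 1
    change (p : G) * q * h * ((p : G) * q)⁻¹ = _
    group
  rw [Finset.sum_congr rfl fun p _ => hp p, Finset.sum_const, nsmul_eq_mul, Finset.card_univ,
    Nat.card_eq_fintype_card]

end

end

/-! ### The Borromean tensor of simple objects -/

theorem mainTheorem4 {G : Type u} [Group G] [Fintype G] (ω : NormalizedThreeCocycle G)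
    (A : Subgroup G) [A.Normal] (hA : ∀ a ∈ A, ∀ b ∈ A, a * b = b * a)
    (hω : ∃ ω' : NormalizedThreeCocycle (G ⧸ A), ω = ω'.inflate)
    (g h k : G) (hg : g ∈ A) (hh : h ∈ A) :
    (∀ (χ₁ : Subgroup.centralizer ({g} : Set G) → ℂ) (χ₂ : Subgroup.centralizer ({h} : Set G) → ℂ)
        (χ₃ : Subgroup.centralizer ({k} : Set G) → ℂ) (U V W : Center (VectG ω)),
        IsSimpleWithParams U g χ₁ → IsSimpleWithParams V h χ₂ → IsSimpleWithParams W k χ₃ →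
        ∀ (Q : Subgroup G) [Fintype Q], Q ≤ Subgroup.centralizer ({k} : Set G) →
          conjOrbit Q g = conjugatesOf g → conjOrbit Q h = conjugatesOf h →
          borromeanTensor U V W =
            ((conjugatesOf k).ncard : ℂ) * (Nat.card Q : ℂ) * χ₃ 1 /
                ((Nat.card ↥(Q ⊓ Subgroup.centralizer ({g} : Set G)) : ℂ) *
                  (Nat.card ↥(Q ⊓ Subgroup.centralizer ({h} : Set G)) : ℂ)) *
              ∑ q : Q, χ₁ ⟨(q : G) * ⁅h, k⁆ * (q : G)⁻¹, conj_commutator_mem hA hh hg k q⟩ *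
                χ₂ ⟨(q : G)⁻¹ * ⁅k⁻¹, g⁻¹⁆ * (q : G), conj_commutator_mem' hA hg hh k q⟩) ∧
    (∀ Q : Subgroup G, (∀ p ∈ Q, ∀ q ∈ Q, p * q = q * p) → A.IsComplement' Q → k ∈ Q →
      Q ≤ Subgroup.centralizer ({k} : Set G) ∧
        conjOrbit Q g = conjugatesOf g ∧ conjOrbit Q h = conjugatesOf h) := by
  obtain ⟨ω', rfl⟩ := hω
  have hω := ω'.trivialOn_inflate
  refine ⟨?_, fun Q hQ hAQ hk => ⟨fun q hq => ?_,
    conjOrbit_eq_conjugatesOf_of_isComplement' hA hAQ hg,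
    conjOrbit_eq_conjugatesOf_of_isComplement' hA hAQ hh⟩⟩
  swap
  · exact Subgroup.mem_centralizer_singleton_iff.2 (hQ q hq k hk)
  intro χ₁ χ₂ χ₃ U V W hU hV hW Q _ hQk hQg hQh
  have hU' := hU.proj_eq_zero_of_notMem hg
  have hV' := hV.proj_eq_zero_of_notMem hh
  have key := card_mul_sum_eq
    (fun a b c => componentTrace U a ⁅b, c⁆ * componentTrace V b ⁅c⁻¹, a⁻¹⁆ * componentTrace W c 1)
    (g := g) (h := h) (k := k)
    (fun p a b c => by
      have e₁ : ⁅p * b * p⁻¹, p * c * p⁻¹⁆ = p * ⁅b, c⁆ * p⁻¹ := by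
        simp only [commutatorElement_def]
        group
      have e₂ : ⁅(p * c * p⁻¹)⁻¹, (p * a * p⁻¹)⁻¹⁆ = p * ⁅c⁻¹, a⁻¹⁆ * p⁻¹ := by
        simp only [commutatorElement_def]
        group
      rw [e₁, e₂, componentTrace_conj hω U hU', componentTrace_conj hω V hV',
        componentTrace_conj_one])
    (fun a b c ha => by
      rw [componentTrace_of_proj_eq_zero (hU.proj_eq_zero ha), zero_mul, zero_mul])
    (fun a b c hb => by
      rw [componentTrace_of_proj_eq_zero (hV.proj_eq_zero hb), mul_zero, zero_mul])
    (fun a b c hc => by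
      rw [componentTrace_of_proj_eq_zero (hW.proj_eq_zero hc), mul_zero])
    Q hQk hQg hQh
  rw [← borromeanTensor_eq_sum hA hω U V W hU' hV'] at key
  have hterm : ∀ q : Q, componentTrace U g ⁅(q : G) * h * (q : G)⁻¹, k⁆ *
      componentTrace V ((q : G) * h * (q : G)⁻¹) ⁅k⁻¹, g⁻¹⁆ * componentTrace W k 1 = χ₃ 1 *
      (χ₁ ⟨(q : G) * ⁅h, k⁆ * (q : G)⁻¹, conj_commutator_mem hA hh hg k q⟩ *
        χ₂ ⟨(q : G)⁻¹ * ⁅k⁻¹, g⁻¹⁆ * (q : G), conj_commutator_mem' hA hg hh k q⟩) := fun q => by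
    have hqk : (q : G) * k = k * q := Subgroup.mem_centralizer_singleton_iff.1 (hQk q.2)
    have e₁ : ⁅(q : G) * h * (q : G)⁻¹, k⁆ = (q : G) * ⁅h, k⁆ * (q : G)⁻¹ := by
      have hqk' : (q : G)⁻¹ * k * q = k := by rw [mul_assoc, ← hqk, inv_mul_cancel_left]
      have hqk'' : (q : G)⁻¹ * k⁻¹ = k⁻¹ * (q : G)⁻¹ := by rw [← mul_inv_rev, ← mul_inv_rev, hqk]
      calc ⁅(q : G) * h * (q : G)⁻¹, k⁆ =
            q * h * ((q : G)⁻¹ * k * q) * h⁻¹ * ((q : G)⁻¹ * k⁻¹) := by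
              rw [commutatorElement_def]; group
        _ = (q : G) * ⁅h, k⁆ * (q : G)⁻¹ := by
              rw [hqk', hqk'', commutatorElement_def]; group
    have e₂ : componentTrace V ((q : G) * h * (q : G)⁻¹) ⁅k⁻¹, g⁻¹⁆ =
        componentTrace V h ((q : G)⁻¹ * ⁅k⁻¹, g⁻¹⁆ * q) := by
      rw [← componentTrace_conj hω V hV' q h]
      congr 1
      group
    rw [e₁, e₂, hU.character, hV.character, hW.character, mul_comm]
    rfl
  rw [Finset.sum_congr rfl fun q _ => hterm q, ← Finset.mul_sum, ← mul_assoc] at key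
  have hcg : (Nat.card ↥(Q ⊓ Subgroup.centralizer ({g} : Set G)) : ℂ) ≠ 0 :=
    Nat.cast_ne_zero.2 Nat.card_pos.ne'
  have hch : (Nat.card ↥(Q ⊓ Subgroup.centralizer ({h} : Set G)) : ℂ) ≠ 0 :=
    Nat.cast_ne_zero.2 Nat.card_pos.ne'
  rw [div_mul_eq_mul_div, eq_div_iff (mul_ne_zero hcg hch), mul_comm]
  exact key
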